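/- Let $K$ be a perfect field of characteristic $p\ge 0$ with algebraic closure $\overline K$. Call $F\in K[[X]][Y]$ separable in $Y$ if it is separable as a polynomial in $Y$ over $K((X))$, write $F_Y=\partial F/\partial Y$, and let $\mathrm{val}$ be the $X$-adic valuation, extended to the field $\bigcup_{e\ge1}\overline K((X^{1/e}))$ of Puiseux series. For $G,H\in K[[X]][Y]$ such that some power of $X$ lies in the ideal $(G,H)$ of $K[[X]][Y]$, the lifting order of $G$ and $H$ is $\kappa(G,H)=\min\{k\in\mathbb N : X^k\in (G,H)\}$. (1) Let $F\in K[[X]][Y]$ be separable in $Y$, with $p=0$ or $p>\deg_Y F$, and let $F=G\cdot H$ with $G,H\in K[[X]][Y]$, $H$ monic in $Y$ and $H\neq 1$. Then $(G,H)$ contains a power of $X$, the maximum of $\mathrm{val}(F_Y(S))$ over the Puiseux series $S$ with $H(S)=0$ exists (in particular $H$ has such roots) and is finite, and $$\kappa(G,H)\le \max_{H(S)=0}\mathrm{val}(F_Y(S)).$$ (2) Let $F\in K[[X]][Y]$ be monic in $Y$ of degree $d_Y\ge1$ and separable in $Y$, with $p=0$ or $p>d_Y$, and let $\delta=\mathrm{val}(\mathrm{Res}_Y(F,F_Y))$.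 If $F$ is not irreducible in $K[[X]][Y]$, then there are monic polynomials $G,H\in K[[X]][Y]$, both different from $1$, such that $F=GH$, the ideal $(G,H)$ contains a power of $X$, and $$\kappa(G,H)\le \frac{2\delta}{d_Y}.$$ -/

import Mathlib

open scoped PowerSeries LaurentSeries Polynomial

namespace LiftingOrder

noncomputable section

/-- A Hahn series with rational exponents is a Puiseux series if its exponents have a common
denominator `e`. As the support of a Hahn series is well-ordered, the Puiseux series with
coefficients in `L` are exactly the elements of the union over `e ≥ 1` of `L((X^(1/e)))`. -/
def IsPuiseux {L : Type*} [Field L] (S : HahnSeries ℚ L) : Prop :=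
  ∃ e : ℕ, 0 < e ∧ ∀ q ∈ S.support, ∃ k : ℤ, q = (k : ℚ) / (e : ℚ)

/-- The inclusion of `K[[X]]` in the series with rational exponents over an algebraic closure of
`K`; the power `X ^ n` goes to the monomial of exponent `(n : ℚ)`. -/
def toPuiseux (K : Type*) [Field K] : K⟦X⟧ →+* HahnSeries ℚ (AlgebraicClosure K) :=
  (HahnSeries.ofPowerSeries ℚ (AlgebraicClosure K)).comp
    (PowerSeries.map (algebraMap K (AlgebraicClosure K)))

/-- The value `P(S)` of `P ∈ K[[X]][Y]` at a series `S`. -/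
def evalAt {K : Type*} [Field K] (P : K⟦X⟧[X]) (S : HahnSeries ℚ (AlgebraicClosure K)) :
    HahnSeries ℚ (AlgebraicClosure K) :=
  P.eval₂ (toPuiseux K) S

/-- The values `val (F_Y(S))`, for the Puiseux series `S` with `H(S) = 0`. The valuation is the
least exponent of a series, and `⊤` for the zero series. -/
def derivValuations {K : Type*} [Field K] (F H : K⟦X⟧[X]) : Set (WithTop ℚ) :=
  {v | ∃ S : HahnSeries ℚ (AlgebraicClosure K),
    IsPuiseux S ∧ evalAt H S = 0 ∧ v = (evalAt F.derivative S).orderTop}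

/-- `F ∈ K[[X]][Y]` is separable with respect to `Y`, that is, separable over the field
`K((X))`. -/
def SeparableInY {K : Type*} [Field K] (F : K⟦X⟧[X]) : Prop :=
  (F.map (algebraMap K⟦X⟧ K⸨X⸩)).Separable

/-- The exponents `k` with `X ^ k` in the ideal `(G, H)` of `K[[X]][Y]`. -/
def liftingExponents {K : Type*} [Field K] (G H : K⟦X⟧[X]) : Set ℕ :=
  {k | Polynomial.C ((PowerSeries.X : K⟦X⟧) ^ k) ∈ Ideal.span {G, H}}

/-- The lifting order `κ(G, H)`: the least `k` with `X ^ k ∈ (G, H)`. It is meaningful if there is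
such a `k`, that is, if `liftingExponents G H` is not empty. -/
def kappa {K : Type*} [Field K] (G H : K⟦X⟧[X]) : ℕ :=
  sInf (liftingExponents G H)

/-- The `X`-adic valuation of `Res_Y(F, F_Y)`. It is used for separable `F`, for which the
resultant is not zero. -/
def delta {K : Type*} [Field K] (F : K⟦X⟧[X]) : ℕ :=
  (Polynomial.resultant F F.derivative).order.toNat

end

end LiftingOrder

/-!
The lifting order is bounded through Lagrange interpolation. Let `H` have the roots `S₁, …, S_d`
in the Puiseux series. The inverse of `G` modulo `H` has the value `1 / G(Sᵢ)` at `Sᵢ`, so it is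
the sum of `∏_{j ≠ i} (Y - Sⱼ) / (G(Sᵢ) * H_Y(Sᵢ))`, where `G(Sᵢ) * H_Y(Sᵢ) = F_Y(Sᵢ)`. The `Sᵢ`
are integral, so that multiplication by `X ^ k` makes the inverse integral as soon as `k ≥ val
(F_Y(Sᵢ))` for all `i`; as the coefficients are in `K((X))`, the floor of the maximum is enough.
This is `mem_liftingExponents_of_order_le`.

The roots exist by the Newton–Puiseux theorem `splitsTamely_of_monic`, which holds as all positive
integers up to the degree are invertible. They are power series in `T = X ^ (1 / e)` with `e`
invertible, and the valuations are computed in `L⟦T⟧` with `L` an algebraic closure of `K`.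

For the second part, `δ` is the sum of `val (F_Y(S))` over the `d` roots of `F`, so the least of
these values is at most `δ / d`. The roots where it is attained are permuted by the automorphisms
of `L` over `K` and by `T ↦ ζ * T` with `ζ ^ e = 1`, because they preserve valuations. As `K` is
perfect and `e` is invertible, these roots are the roots of a factor `H` of `F` over `K⟦X⟧`. If `H
≠ F`, then `F = (F / H) * H` is the factorization wanted; if `H = F`, all roots have the same
value of `val (F_Y(S))`, and every factorization of `F` will do. This gives the bound `δ / d`,
better than `2 * δ / d`.
-/

namespace LiftingOrder

/-! ### The Newton–Puiseux theorem in the tame case -/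

open Polynomial in
/-- The form of Hensel's lemma used here: over a complete local ring, the roots of a monic `Q` that
reduce to `0` can be split off. Weierstrass preparation gives `Q = P * h` with a power series `h`
in the variable of `Q`; the uniqueness of Weierstrass division shows that `h` is a polynomial. -/
lemma exists_isDistinguishedAt_mul {A : Type*} [CommRing A] [IsLocalRing A]
    [IsAdicComplete (IsLocalRing.maximalIdeal A) A] {Q : A[X]} (hQ : Q.Monic)
    (h0 : Q.coeff 0 ∈ IsLocalRing.maximalIdeal A) :
    ∃ P R : A[X], P.IsDistinguishedAt (IsLocalRing.maximalIdeal A) ∧ P.natDegree ≠ 0 ∧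
      Q = P * R := by
  have hne : (Q : A⟦X⟧).map (IsLocalRing.residue A) ≠ 0 := by
    rw [← Polynomial.polynomial_map_coe]
    exact_mod_cast (hQ.map _).ne_zero
  obtain ⟨P, h, hw⟩ := PowerSeries.exists_isWeierstrassFactorization hne
  have hP := hw.isDistinguishedAt
  refine ⟨P, Q /ₘ P, hP, fun hd ↦ ?_, ?_⟩
  · have hP1 : P = 1 := eq_one_of_monic_natDegree_zero hP.monic hd
    have hu := hw.isUnit
    have heq := hw.eq_mul
    rw [hP1, Polynomial.coe_one, one_mul] at heq
    rw [← heq, PowerSeries.isUnit_iff_constantCoeff] at hu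
    simp only [constantCoeff_coe] at hu
    exact (IsLocalRing.mem_maximalIdeal _).1 h0 hu
  -- `P * h + 0` and `P * (Q /ₘ P) + Q %ₘ P` are two Weierstrass divisions of `Q` by `P`
  · have hI : IsLocalRing.maximalIdeal A ≠ ⊤ := Ideal.IsMaximal.ne_top inferInstance
    have hord : P.natDegree = _ := congr(ENat.toNat $(hP.coe_natDegree_eq_order_map P 1
      (by rwa [PowerSeries.constantCoeff_one, ← Ideal.ne_top_iff_one]) (by simp)))
    have key := (hP.isWeierstrassDivisorAt hI).eq_of_mul_add_eq_mul_add
      (q := h) (q' := ((Q /ₘ P : A[X]) : A⟦X⟧)) (r := 0) (r' := Q %ₘ P)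
      (by simp)
      (by
        rw [← hord, ← degree_eq_natDegree hP.monic.ne_zero]
        exact degree_modByMonic_lt _ hP.monic)
      (by
        rw [Polynomial.coe_zero, add_zero, ← hw.eq_mul, ← Polynomial.coe_mul,
          ← Polynomial.coe_add, add_comm, modByMonic_add_div])
    conv_lhs => rw [← modByMonic_add_div Q P, ← key.2, zero_add]

instance isAdicComplete_maximalIdeal (L : Type*) [Field L] :
    IsAdicComplete (IsLocalRing.maximalIdeal L⟦X⟧) L⟦X⟧ := by
  rw [PowerSeries.maximalIdeal_eq_span_X]
  infer_instance

open Polynomial in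
/-- The effect of `X ↦ X + r` on the second highest coefficient, which a suitable `r` makes vanish
if `n + 1` is invertible. -/
lemma coeff_taylor_natDegree_sub_one {R : Type*} [CommRing R] {f : R[X]} {n : ℕ}
    (hf : f.Monic) (hn : f.natDegree = n + 1) (r : R) :
    (taylor r f).coeff n = f.coeff n + (n + 1) * r := by
  rw [taylor_coeff, eval_eq_sum_range' (n := 2)]
  · have : f.coeff (n + 1) = 1 := by rw [← hn]; exact hf
    simp [Finset.sum_range_succ, hasseDeriv_coeff, this, add_comm 1 n]
  · have := natDegree_hasseDeriv_le f n
    omega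

open Polynomial in
lemma exists_scaleRoots_eq {R : Type*} [CommRing R] [Nontrivial R] {f : R[X]} (hf : f.Monic) {r : R}
    (h : ∀ i < f.natDegree, r ^ (f.natDegree - i) ∣ f.coeff i) :
    ∃ g : R[X], g.Monic ∧ g.natDegree = f.natDegree ∧ g.scaleRoots r = f := by
  choose! b hb using h
  have hdeg : degree (∑ i ∈ Finset.range f.natDegree, monomial i (b i)) < f.natDegree := by
    refine (degree_sum_le _ _).trans_lt ((Finset.sup_lt_iff (WithBot.bot_lt_coe _)).2
      fun i hi ↦ (degree_monomial_le _ _).trans_lt ?_)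
    exact_mod_cast Finset.mem_range.1 hi
  set g := X ^ f.natDegree + ∑ i ∈ Finset.range f.natDegree, monomial i (b i) with hg
  have hgm : g.Monic := monic_X_pow_add hdeg
  have hgn : g.natDegree = f.natDegree := by
    rw [hg, natDegree_add_eq_left_of_degree_lt] <;> simp [hdeg]
  refine ⟨g, hgm, hgn, ?_⟩
  ext i
  rw [coeff_scaleRoots, hgn]
  rcases lt_trichotomy i f.natDegree with hi | hi | hi
  · rw [hb i hi, hg]
    simp [coeff_X_pow, hi.ne, finsetSum_coeff, coeff_monomial, hi, mul_comm]
  · subst hi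
    rw [← hgn, coeff_natDegree, hgm, hgn, coeff_natDegree, hf]
    simp
  · rw [coeff_eq_zero_of_natDegree_lt hi, coeff_eq_zero_of_natDegree_lt (by omega), zero_mul]

/-- `H`, a polynomial over `L⟦X⟧`, splits over `L⟦X⟧` after a substitution `X ↦ X ^ e`, where `e`
is not divisible by the characteristic of `L`. In other words, the roots of `H` are power series
in `X ^ (1 / e)`. -/
def SplitsTamely {L : Type*} [Field L] (H : L⟦X⟧[X]) : Prop :=
  ∃ (e : ℕ) (he : e ≠ 0), (e : L) ≠ 0 ∧
    (H.map (PowerSeries.expand e he : L⟦X⟧ →ₐ[L] L⟦X⟧).toRingHom).Splits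

namespace SplitsTamely

variable {L : Type*} [Field L] {H H' : L⟦X⟧[X]}

lemma of_splits (h : H.Splits) : SplitsTamely H :=
  ⟨1, one_ne_zero, by simp, h.map _⟩

lemma of_map_expand {e : ℕ} (he : e ≠ 0) (heL : (e : L) ≠ 0)
    (h : SplitsTamely (H.map (PowerSeries.expand e he : L⟦X⟧ →ₐ[L] L⟦X⟧).toRingHom)) :
    SplitsTamely H := by
  obtain ⟨d, hd, hdL, hs⟩ := h
  refine ⟨d * e, mul_ne_zero hd he, by simp [hdL, heL], ?_⟩
  rw [Polynomial.map_map] at hs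
  convert hs using 2
  ext1 x
  exact PowerSeries.expand_mul d hd e he x

lemma mul (h : SplitsTamely H) (h' : SplitsTamely H') : SplitsTamely (H * H') := by
  obtain ⟨d, hd, hdL, hs⟩ := h
  obtain ⟨e, he, heL, hs'⟩ := h'
  refine ⟨d * e, mul_ne_zero hd he, by simp [hdL, heL], ?_⟩
  rw [Polynomial.map_mul]
  refine Polynomial.Splits.mul ?_ ?_
  · have := hs.map (PowerSeries.expand e he : L⟦X⟧ →ₐ[L] L⟦X⟧).toRingHom
    rw [Polynomial.map_map] at this
    convert this using 2
    ext1 x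
    simp only [mul_comm d e]
    exact PowerSeries.expand_mul e he d hd x
  · have := hs'.map (PowerSeries.expand d hd : L⟦X⟧ →ₐ[L] L⟦X⟧).toRingHom
    rw [Polynomial.map_map] at this
    convert this using 2
    ext1 x
    exact PowerSeries.expand_mul d hd e he x

lemma taylor (h : SplitsTamely H) (a : L⟦X⟧) : SplitsTamely (Polynomial.taylor a H) := by
  obtain ⟨d, hd, hdL, hs⟩ := h
  refine ⟨d, hd, hdL, ?_⟩
  rw [Polynomial.map_taylor]
  exact hs.taylor _

lemma of_taylor {a : L⟦X⟧} (h : SplitsTamely (Polynomial.taylor a H)) : SplitsTamely H := by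
  simpa [Polynomial.taylor_taylor] using h.taylor (-a)

lemma scaleRoots (h : SplitsTamely H) (hH : H.Monic) (r : L⟦X⟧) :
    SplitsTamely (H.scaleRoots r) := by
  obtain ⟨d, hd, hdL, hs⟩ := h
  refine ⟨d, hd, hdL, ?_⟩
  rw [Polynomial.map_scaleRoots _ _ _ (by simp [hH.leadingCoeff])]
  exact hs.scaleRoots _

end SplitsTamely

open Polynomial in
/-- If the second highest coefficient of `Q` vanishes, the degree is invertible and some lower
coefficient is a unit, then `Q` modulo `X` is not a power of a linear polynomial, so
that Hensel's lemma at one of its roots `c` gives a nontrivial factorization. -/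
lemma exists_monic_mul_of_coeff_natDegree_sub_one {L : Type*} [Field L] [IsAlgClosed L]
    {Q : L⟦X⟧[X]} (hQ : Q.Monic) {n : ℕ} (hn : Q.natDegree = n + 1) (hnL : ((n + 1 : ℕ) : L) ≠ 0)
    (hc : Q.coeff n = 0) {i : ℕ} (hi : i ≤ n)
    (hi0 : PowerSeries.constantCoeff (Q.coeff i) ≠ 0) :
    ∃ (c : L) (P R : L⟦X⟧[X]), P.Monic ∧ R.Monic ∧ P.natDegree ≤ n ∧ R.natDegree ≤ n ∧
      taylor (PowerSeries.C c) Q = P * R := by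
  set q := Q.map (PowerSeries.constantCoeff (R := L)) with hq
  have hqm : q.Monic := hQ.map _
  have hqn : q.natDegree = n + 1 := by rw [hq, hQ.natDegree_map, hn]
  obtain ⟨c, hroot⟩ := IsAlgClosed.exists_root q (by
    rw [degree_eq_natDegree hqm.ne_zero, hqn]; exact_mod_cast Nat.succ_ne_zero n)
  have hmap : (taylor (PowerSeries.C c) Q).map (PowerSeries.constantCoeff (R := L)) =
      taylor c q := by
    rw [map_taylor]; simp [hq]
  have htm : (taylor (PowerSeries.C c) Q).Monic := by
    rw [Monic, leadingCoeff_taylor]; exact hQ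
  have htn : (taylor (PowerSeries.C c) Q).natDegree = n + 1 := by rw [natDegree_taylor, hn]
  obtain ⟨P, R, hP, hPd, hPR⟩ := exists_isDistinguishedAt_mul htm (by
    rw [PowerSeries.maximalIdeal_eq_span_X, Ideal.mem_span_singleton, PowerSeries.X_dvd_iff,
      ← coeff_map, hmap, taylor_coeff_zero]
    exact hroot)
  have hRm : R.Monic := hP.monic.of_mul_monic_left (hPR ▸ htm)
  have hdeg : P.natDegree + R.natDegree = n + 1 := by
    rw [← hP.monic.natDegree_mul hRm, ← hPR, htn]
  refine ⟨c, P, R, hP.monic, hRm, ?_, by omega, hPR⟩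
  by_contra! hlt
  have hR1 : R = 1 := eq_one_of_monic_natDegree_zero hRm (by omega)
  -- then `Q` has a single root modulo `X`, which vanishes as the second coefficient does
  have hPX : taylor c q = X ^ (n + 1) := by
    rw [← hmap, hPR, hR1, mul_one]
    ext j
    rw [coeff_map, coeff_X_pow]
    split_ifs with hj
    · have : P.coeff j = 1 := by
        rw [hj, show n + 1 = P.natDegree by omega]; exact hP.monic
      simp [this]
    · rcases lt_or_gt_of_ne hj with hj | hj
      · have := hP.mem (show j < P.natDegree by omega)
        rwa [PowerSeries.maximalIdeal_eq_span_X, Ideal.mem_span_singleton,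
          PowerSeries.X_dvd_iff] at this
      · rw [coeff_eq_zero_of_natDegree_lt (by omega), map_zero]
  have h1 := coeff_taylor_natDegree_sub_one hqm hqn c
  rw [hPX, coeff_X_pow, if_neg (by omega), hq, coeff_map, hc, map_zero, zero_add] at h1
  have hc0 : c = 0 := by
    have := mul_eq_zero.1 h1.symm
    push_cast at hnL
    exact this.resolve_left hnL
  rw [hc0, taylor_zero] at hPX
  apply hi0
  rw [← coeff_map, ← hq, hPX, coeff_X_pow, if_neg (by omega)]

open Polynomial in
/-- **The Newton–Puiseux theorem** in the tame case. By induction on the degree: once the second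
highest coefficient is removed, the first edge of the Newton polygon gives a substitution
`X ↦ X ^ e`, `Y ↦ X ^ m * Y` that leads to a polynomial with a nontrivial factorization. -/
theorem splitsTamely_of_monic {L : Type*} [Field L] [IsAlgClosed L] {H : L⟦X⟧[X]} (hH : H.Monic)
    (hL : ∀ k : ℕ, 0 < k → k ≤ H.natDegree → (k : L) ≠ 0) : SplitsTamely H := by
  induction hN : H.natDegree using Nat.strong_induction_on generalizing H with
  | h N ih =>
  subst hN
  rcases hd : H.natDegree with _ | n
  · exact .of_splits (.of_natDegree_le_one_of_monic (by omega) hH)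
  have hnL : ((n + 1 : ℕ) : L) ≠ 0 := hL _ (by omega) hd.ge
  apply SplitsTamely.of_taylor (a := -PowerSeries.C ((n + 1 : ℕ) : L)⁻¹ * H.coeff n)
  set F := taylor (-PowerSeries.C ((n + 1 : ℕ) : L)⁻¹ * H.coeff n) H with hF
  have hFm : F.Monic := by
    rw [Monic, leadingCoeff_taylor]; exact hH
  have hFn : F.natDegree = n + 1 := by rw [hF, natDegree_taylor, hd]
  have hF0 : F.coeff n = 0 := by
    rw [hF, coeff_taylor_natDegree_sub_one hH hd]
    have : ((n : L⟦X⟧) + 1) * PowerSeries.C ((n + 1 : ℕ) : L)⁻¹ = 1 := by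
      rw [show ((n : L⟦X⟧) + 1) = PowerSeries.C ((n + 1 : ℕ) : L) by simp, ← map_mul,
        mul_inv_cancel₀ hnL, map_one]
    linear_combination (-H.coeff n) * this
  by_cases hS : ∀ i ≤ n, F.coeff i = 0
  · have : F = X ^ (n + 1) := by
      ext i : 1
      rw [coeff_X_pow]
      split_ifs with hi
      · rw [hi, ← hFn]; exact hFm
      · rcases le_or_gt i n with h | h
        · exact hS i h
        · exact coeff_eq_zero_of_natDegree_lt (by omega)
    rw [this]
    exact .of_splits (.X_pow _)
  push Not at hS
  classical
  -- `i` is such that the slope `ord (F.coeff i) / (n + 1 - i)` is least; with `e = n + 1 - i` and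
  -- `m = ord (F.coeff i)`, this least slope is `m / e`
  obtain ⟨i, hi, hmin⟩ := Finset.exists_min_image
    ((Finset.range (n + 1)).filter fun i ↦ F.coeff i ≠ 0)
    (fun i ↦ ((F.coeff i).order.toNat : ℚ) / ((n + 1 - i : ℕ) : ℚ)) (by
      obtain ⟨i, h1, h2⟩ := hS
      exact ⟨i, by simpa [h2] using Nat.lt_succ_of_le h1⟩)
  simp only [Finset.mem_filter, Finset.mem_range, and_imp] at hi hmin
  obtain ⟨hin, hi0⟩ := hi
  set m := (F.coeff i).order.toNat with hm
  have he : n + 1 - i ≠ 0 := by omega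
  have heL : ((n + 1 - i : ℕ) : L) ≠ 0 := hL _ (by omega) (by omega)
  apply SplitsTamely.of_map_expand he heL
  set ex := (PowerSeries.expand (n + 1 - i) he : L⟦X⟧ →ₐ[L] L⟦X⟧).toRingHom with hex
  have hord : ∀ x : L⟦X⟧, (ex x).order = (n + 1 - i) • x.order :=
    fun x ↦ PowerSeries.order_expand (n + 1 - i) he x
  have hFem : (F.map ex).Monic := hFm.map _
  have hFen : (F.map ex).natDegree = n + 1 := by rw [hFm.natDegree_map, hFn]
  obtain ⟨Q, hQm, hQn, hQs⟩ := exists_scaleRoots_eq hFem (r := PowerSeries.X ^ m) (by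
    intro j hj
    rw [hFen] at hj ⊢
    rw [coeff_map]
    by_cases hj0 : F.coeff j = 0
    · simp [hj0]
    have h1 := hmin j hj hj0
    rw [div_le_div_iff₀ (by exact_mod_cast Nat.pos_of_ne_zero he)
      (by exact_mod_cast (by omega : 0 < n + 1 - j))] at h1
    have h2 : m * (n + 1 - j) ≤ (F.coeff j).order.toNat * (n + 1 - i) := by exact_mod_cast h1
    rw [← pow_mul, PowerSeries.X_pow_dvd_iff]
    intro k hk
    apply PowerSeries.coeff_of_lt_order
    rw [hord, ← PowerSeries.coe_toNat_order hj0, nsmul_eq_mul]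
    norm_cast
    rw [mul_comm]
    exact hk.trans_le h2)
  rw [hFen] at hQn
  rw [← hQs]
  refine SplitsTamely.scaleRoots ?_ hQm _
  have hXm : (PowerSeries.X : L⟦X⟧) ≠ 0 := PowerSeries.X_ne_zero
  have hcoef : ∀ j, Q.coeff j * (PowerSeries.X ^ m) ^ (n + 1 - j) = ex (F.coeff j) := by
    intro j
    rw [← coeff_map, ← hQs, coeff_scaleRoots, hQn]
  obtain ⟨c, P, R, hP, hR, hPn, hRn, hPR⟩ :=
    exists_monic_mul_of_coeff_natDegree_sub_one hQm hQn hnL (i := i) (by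
      have := hcoef n
      rw [hF0, map_zero] at this
      exact (mul_eq_zero.1 this).resolve_right (pow_ne_zero _ (pow_ne_zero _ hXm)))
      (by omega) (by
        intro h0
        have h1 := congrArg PowerSeries.order (hcoef i)
        rw [PowerSeries.order_mul, hord, ← pow_mul, PowerSeries.order_X_pow,
          ← PowerSeries.coe_toNat_order hi0, ← hm, nsmul_eq_mul] at h1
        have h2 := PowerSeries.one_le_order_iff_constCoeff_eq_zero.2 h0
        have h3 : (1 : ℕ∞) + (m * (n + 1 - i) : ℕ) ≤ ((n + 1 - i) * m : ℕ) := by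
          push_cast at h1 ⊢
          rw [← h1]
          gcongr
        norm_cast at h3
        rw [mul_comm m] at h3
        omega)
  apply SplitsTamely.of_taylor (a := PowerSeries.C c)
  rw [hPR]
  exact (ih _ (by omega) hP (fun k h1 h2 ↦ hL k h1 (by omega)) rfl).mul
    (ih _ (by omega) hR (fun k h1 h2 ↦ hL k h1 (by omega)) rfl)

/-! ### The bound for the lifting order -/

section bound

open Polynomial Lagrange in
lemma eval_nodal_id {A : Type*} [CommRing A] {s : Finset A} {a : A} (ha : a ∈ s) :
    eval a (nodal s id) = 0 :=
  eval_nodal_at_node (v := id) ha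

open Polynomial Lagrange in
/-- Let `H = ∏ a ∈ s, (Y - a)` and `U * G ≡ c` modulo `H`. Lagrange interpolation of `U` at the
roots of `H` has the values `c / G(a)` and the denominators `H'(a)`, so a common multiple `t` of
the `G(a) * H'(a)` makes `(t / c) * U` integral. -/
lemma C_dvd_C_mul_of_dvd_eval_derivative_nodal {A : Type*} [CommRing A] [IsDomain A]
    {s : Finset A} {U V G : A[X]} {c t : A} (h : U * G + V * nodal s id = C c)
    (hU : U.degree < s.card)
    (ht : ∀ a ∈ s, eval a G * eval a (derivative (nodal s id)) ∣ t) : C c ∣ C t * U := by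
  classical
  choose! w hw using ht
  have hsm : ∀ (r : A) (f : A[X]), (C r * f).degree ≤ f.degree := fun r f ↦ by
    rw [← smul_eq_C_mul]; exact degree_smul_le r f
  -- Lagrange interpolation: `G(a) * H'(a) * w a = t`
  refine ⟨∑ a ∈ s, C (w a) * nodal (s.erase a) id, ?_⟩
  refine eq_of_degrees_lt_of_eval_finset_eq s ((hsm t U).trans_lt hU) ?_ ?_
  · refine (hsm _ _).trans_lt ((degree_sum_le _ _).trans_lt
      ((Finset.sup_lt_iff (WithBot.bot_lt_coe _)).2 fun a ha ↦
        (hsm _ _).trans_lt ?_))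
    rw [degree_nodal]
    exact_mod_cast Finset.card_erase_lt_of_mem ha
  · intro b hb
    have hb0 := eval_nodal_id hb
    have h1 := congrArg (eval b) h
    simp only [eval_add, eval_mul, eval_C, hb0, mul_zero, add_zero] at h1
    rw [eval_mul, eval_mul, eval_C, eval_C, eval_finsetSum, Finset.sum_eq_single_of_mem b hb]
    · have h2 : eval b (derivative (nodal s id)) = eval b (nodal (s.erase b) id) :=
        eval_nodal_derivative_eval_node_eq (v := id) hb
      rw [eval_mul, eval_C, ← h2, ← h1]
      conv_lhs => rw [hw b hb]
      ring
    · intro a ha hab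
      rw [eval_mul, eval_nodal_id (Finset.mem_erase.2 ⟨hab.symm, hb⟩), mul_zero]

variable {K : Type*} [Field K]

open Polynomial in
lemma exists_map_eq_C_X_pow_mul (f : K⸨X⸩[X]) :
    ∃ (k : ℕ) (g : K⟦X⟧[X]), g.map (algebraMap K⟦X⟧ K⸨X⸩) =
      C (algebraMap K⟦X⟧ K⸨X⸩ (PowerSeries.X ^ k)) * f := by
  obtain ⟨b, ⟨k, rfl⟩, hb⟩ :=
    IsLocalization.integerNormalization_spec (Submonoid.powers (PowerSeries.X : K⟦X⟧)) f
  refine ⟨k, _, hb.trans ?_⟩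
  rw [← IsScalarTower.algebraMap_smul K⸨X⸩, smul_eq_C_mul]

open Polynomial in
lemma exists_mul_add_mul_eq_C_X_pow {f g : K⟦X⟧[X]}
    (h : IsCoprime (f.map (algebraMap K⟦X⟧ K⸨X⸩)) (g.map (algebraMap K⟦X⟧ K⸨X⸩))) :
    ∃ (k : ℕ) (u v : K⟦X⟧[X]), u * f + v * g = C (PowerSeries.X ^ k) := by
  obtain ⟨a, b, hab⟩ := h
  obtain ⟨m, u, hu⟩ := exists_map_eq_C_X_pow_mul a
  obtain ⟨n, v, hv⟩ := exists_map_eq_C_X_pow_mul b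
  refine ⟨m + n, C (PowerSeries.X ^ n) * u, C (PowerSeries.X ^ m) * v, ?_⟩
  apply map_injective _ (IsFractionRing.injective K⟦X⟧ K⸨X⸩)
  simp only [Polynomial.map_add, Polynomial.map_mul, map_C, hu, hv, pow_add, map_mul]
  linear_combination C ((algebraMap K⟦X⟧ K⸨X⸩) (PowerSeries.X ^ m)) *
    C ((algebraMap K⟦X⟧ K⸨X⸩) (PowerSeries.X ^ n)) * hab

lemma order_map_fieldHom {L : Type*} [Field L] (σ : K →+* L) (y : K⟦X⟧) :
    (PowerSeries.map σ y).order = y.order := by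
  refine le_antisymm ?_ (PowerSeries.le_order_map _)
  by_cases hy : y = 0
  · simp [hy]
  rw [← PowerSeries.coe_toNat_order hy]
  exact PowerSeries.order_le _ (by simpa using PowerSeries.coeff_order hy)

section ramify

variable (K) (L : Type*) [Field L] [Algebra K L]

/-- The embedding `K⟦X⟧ → L⟦T⟧`, `X ↦ T ^ e`, so that `T` plays the part of `X ^ (1 / e)`. -/
noncomputable def ramify (e : ℕ) (he : e ≠ 0) : K⟦X⟧ →+* L⟦X⟧ :=
  (PowerSeries.expand e he : L⟦X⟧ →ₐ[L] L⟦X⟧).toRingHom.comp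
    (PowerSeries.map (algebraMap K L))

variable {e : ℕ} (he : e ≠ 0)

lemma coeff_ramify (x : K⟦X⟧) (n : ℕ) : PowerSeries.coeff n (ramify K L e he x) =
    if e ∣ n then algebraMap K L (PowerSeries.coeff (n / e) x) else 0 := by
  have := PowerSeries.coeff_expand e he (PowerSeries.map (algebraMap K L) x) (n := n)
  rw [PowerSeries.coeff_map] at this
  exact this

lemma order_ramify (x : K⟦X⟧) : (ramify K L e he x).order = e * x.order := by
  rw [← order_map_fieldHom (algebraMap K L) x, ← nsmul_eq_mul]
  exact PowerSeries.order_expand e he _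

lemma ramify_injective : Function.Injective (ramify K L e he) := by
  rw [injective_iff_map_eq_zero]
  intro x hx
  have h := order_ramify K L he x
  rw [hx, PowerSeries.order_zero] at h
  by_contra hx0
  rw [← PowerSeries.coe_toNat_order hx0] at h
  norm_cast at h

lemma ramify_X_pow (k : ℕ) : ramify K L e he (PowerSeries.X ^ k) = PowerSeries.X ^ (e * k) := by
  have h : ramify K L e he PowerSeries.X = PowerSeries.X ^ e := by
    have := PowerSeries.expand_X (R := L) e he
    simp only [ramify, RingHom.comp_apply, PowerSeries.map_X]
    exact this
  rw [map_pow, h, pow_mul]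

end ramify

lemma SeparableInY.eval_derivative_ne_zero {F : K⟦X⟧[X]} (hF : SeparableInY F) {L : Type*} [Field L]
    [Algebra K L] {e : ℕ} (he : e ≠ 0) {a : L⟦X⟧}
    (ha : (F.map (ramify K L e he)).eval a = 0) :
    (F.derivative.map (ramify K L e he)).eval a ≠ 0 := by
  have hc : IsCoprime (F.map (algebraMap K⟦X⟧ K⸨X⸩))
      (F.derivative.map (algebraMap K⟦X⟧ K⸨X⸩)) := by
    rw [← Polynomial.derivative_map]; exact hF
  obtain ⟨k, u, v, huv⟩ := exists_mul_add_mul_eq_C_X_pow hc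
  intro h0
  have h1 := congrArg (fun P ↦ (P.map (ramify K L e he)).eval a) huv
  simp only [Polynomial.map_add, Polynomial.map_mul, Polynomial.eval_add, Polynomial.eval_mul, ha,
    h0, mul_zero, add_zero, Polynomial.map_C, Polynomial.eval_C, ramify_X_pow] at h1
  exact pow_ne_zero _ PowerSeries.X_ne_zero h1.symm

open Polynomial Lagrange in
lemma SeparableInY.exists_eq_nodal_of_splits {F G H : K⟦X⟧[X]} (hF : SeparableInY F)
    (hGH : F = G * H) (hH : H.Monic) {L : Type*} [Field L] [Algebra K L] {e : ℕ} (he : e ≠ 0)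
    (hs : (H.map (ramify K L e he)).Splits) :
    ∃ s : Finset L⟦X⟧, H.map (ramify K L e he) = nodal s id := by
  classical
  refine ⟨(H.map (ramify K L e he)).roots.toFinset, ?_⟩
  have hHe : (H.map (ramify K L e he)).Monic := hH.map _
  have hnd : (H.map (ramify K L e he)).roots.Nodup := by
    rw [Multiset.nodup_iff_count_le_one]
    intro a
    by_contra! hlt
    have hroot : (H.map (ramify K L e he)).eval a = 0 :=
      isRoot_of_mem_roots (Multiset.count_pos.1 (by omega))
    refine hF.eval_derivative_ne_zero he (a := a) ?_ ?_
    · rw [hGH, Polynomial.map_mul, eval_mul, hroot, mul_zero]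
    · rw [hGH, ← derivative_map, Polynomial.map_mul, derivative_mul, eval_add, eval_mul, eval_mul,
        hroot, mul_zero, zero_add]
      rw [count_roots] at hlt
      have := (one_lt_rootMultiplicity_iff_isRoot hHe.ne_zero).1 hlt
      rw [this.2.eq_zero, mul_zero]
  conv_lhs => rw [hs.eq_prod_roots_of_monic hHe]
  rw [nodal_eq, Finset.prod_multiset_map_count]
  refine Finset.prod_congr rfl fun a ha ↦ ?_
  rw [Multiset.count_eq_one_of_mem hnd (Multiset.mem_toFinset.1 ha), pow_one, id]

open Polynomial Lagrange in
theorem SeparableInY.exists_map_ramify_eq_nodal {p : ℕ} [CharP K p] {F G H : K⟦X⟧[X]}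
    (hF : SeparableInY F) (hp : p = 0 ∨ F.natDegree < p) (hGH : F = G * H) (hH : H.Monic)
    (L : Type*) [Field L] [IsAlgClosed L] [Algebra K L] :
    ∃ (e : ℕ) (he : e ≠ 0), (e : L) ≠ 0 ∧
      ∃ s : Finset L⟦X⟧, H.map (ramify K L e he) = nodal s id := by
  have hF0 : F ≠ 0 := by
    rintro rfl
    rw [SeparableInY, Polynomial.map_zero] at hF
    exact not_separable_zero hF
  have hdeg : H.natDegree ≤ F.natDegree := by
    rw [hGH, natDegree_mul (left_ne_zero_of_mul (hGH ▸ hF0)) hH.ne_zero]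
    omega
  have : CharP L p := charP_of_injective_algebraMap (algebraMap K L).injective p
  have hmon : (H.map (PowerSeries.map (algebraMap K L))).Monic := hH.map _
  obtain ⟨e, he, heL, hs⟩ := splitsTamely_of_monic hmon (fun k hk hkn hk0 ↦ by
    rw [hH.natDegree_map] at hkn
    have hpk := (CharP.cast_eq_zero_iff L p k).1 hk0
    rcases hp with rfl | hp
    · exact hk.ne' (zero_dvd_iff.1 hpk)
    · exact absurd (Nat.le_of_dvd hk hpk) (by omega))
  rw [Polynomial.map_map] at hs
  exact ⟨e, he, heL, hF.exists_eq_nodal_of_splits hGH hH he hs⟩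

open Polynomial Lagrange in
/-- The bound for the lifting order: if `val (F_Y(S)) ≤ N / e` for all roots `S` of `H`, where `N`
is the bound for the order in `T = X ^ (1 / e)`, then `X ^ ⌊N / e⌋ ∈ (G, H)`. -/
theorem mem_liftingExponents_of_order_le {F G H : K⟦X⟧[X]} (hF : SeparableInY F) (hGH : F = G * H)
    (hH : H.Monic) {L : Type*} [Field L] [Algebra K L] {e : ℕ} (he : e ≠ 0) {s : Finset L⟦X⟧}
    (hs : H.map (ramify K L e he) = nodal s id) {N : ℕ}
    (hN : ∀ a ∈ s, ((F.derivative.map (ramify K L e he)).eval a).order ≤ N) :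
    N / e ∈ liftingExponents G H := by
  have hco : IsCoprime (G.map (algebraMap K⟦X⟧ K⸨X⸩)) (H.map (algebraMap K⟦X⟧ K⸨X⸩)) := by
    apply Separable.isCoprime
    rw [← Polynomial.map_mul, ← hGH]
    exact hF
  obtain ⟨M, U₀, V₀, hUV₀⟩ := exists_mul_add_mul_eq_C_X_pow hco
  obtain ⟨U, V, hU, hUV⟩ : ∃ U V : K⟦X⟧[X], U.degree < H.degree ∧
      U * G + V * H = C (PowerSeries.X ^ M) := by
    refine ⟨U₀ %ₘ H, V₀ + (U₀ /ₘ H) * G, degree_modByMonic_lt _ hH, ?_⟩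
    rw [← hUV₀]
    linear_combination G * modByMonic_add_div U₀ H
  -- Lagrange interpolation bounds the denominators of `U / X ^ M`, the inverse of `G` modulo `H`
  have hcard : H.degree = s.card := by
    rw [← hH.degree_map (ramify K L e he), hs, degree_nodal]
  have hdvd : C (ramify K L e he (PowerSeries.X ^ M)) ∣
      C (PowerSeries.X ^ N) * U.map (ramify K L e he) := by
    refine C_dvd_C_mul_of_dvd_eval_derivative_nodal (G := G.map (ramify K L e he))
      (V := V.map (ramify K L e he)) (s := s) ?_ ?_ ?_
    · rw [← hs, ← Polynomial.map_mul, ← Polynomial.map_mul, ← Polynomial.map_add, hUV, map_C]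
    · exact degree_map_le.trans_lt (hcard ▸ hU)
    · intro a ha
      have hFa : (F.derivative.map (ramify K L e he)).eval a =
          eval a (G.map (ramify K L e he)) * eval a (derivative (nodal s id)) := by
        rw [hGH, ← derivative_map, Polynomial.map_mul, derivative_mul, hs, eval_add, eval_mul,
          eval_mul, eval_nodal_id ha, mul_zero, zero_add]
      have hle := hN a ha
      rw [← hFa]
      set x := (F.derivative.map (ramify K L e he)).eval a with hx
      have hx0 : x ≠ 0 := by
        rintro h
        rw [h, PowerSeries.order_zero, top_le_iff] at hle
        exact ENat.natCast_ne_top _ hle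
      -- up to a unit, `x` is a power of the uniformizer
      obtain ⟨n, hn⟩ := IsDiscreteValuationRing.associated_pow_irreducible hx0
        PowerSeries.X_irreducible
      obtain ⟨u, hu⟩ := hn
      have hxn : x.order = n := by
        have := congrArg PowerSeries.order hu
        rw [PowerSeries.order_mul, PowerSeries.order_X_pow,
          PowerSeries.order_zero_of_unit u.isUnit, add_zero] at this
        exact this
      rw [hxn] at hle
      exact (Associated.dvd ⟨u, hu⟩).trans (pow_dvd_pow _ (by exact_mod_cast hle))
  -- the coefficients of `U` are in `K⟦X⟧`, which allows the floor of `N / e`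
  have hdvdU : C (PowerSeries.X ^ M) ∣ C (PowerSeries.X ^ (N / e)) * U := by
    rw [C_dvd_iff_dvd_coeff] at hdvd ⊢
    intro i
    have h1 := hdvd i
    rw [coeff_C_mul, coeff_map, ramify_X_pow] at h1
    rw [coeff_C_mul]
    by_cases hU0 : U.coeff i = 0
    · simp [hU0]
    obtain ⟨y, hy⟩ := h1
    have h2 := congrArg PowerSeries.order hy
    rw [PowerSeries.order_mul, PowerSeries.order_mul, PowerSeries.order_X_pow,
      PowerSeries.order_X_pow, order_ramify, ← PowerSeries.coe_toNat_order hU0] at h2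
    have h3 : ((e * M : ℕ) : ℕ∞) ≤ (N + e * (U.coeff i).order.toNat : ℕ) := by
      push_cast at h2 ⊢
      rw [h2]
      exact le_self_add
    norm_cast at h3
    have h4 : M ≤ N / e + (U.coeff i).order.toNat := by
      rw [← Nat.add_mul_div_left _ _ (Nat.pos_of_ne_zero he),
        Nat.le_div_iff_mul_le (Nat.pos_of_ne_zero he), mul_comm]
      exact h3
    refine (pow_dvd_pow _ h4).trans ?_
    rw [pow_add]
    exact mul_dvd_mul_left _ PowerSeries.X_pow_order_dvd
  obtain ⟨U', hU'⟩ := hdvdU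
  -- `X ^ ⌊N / e⌋ * V` is a multiple of `X ^ M` as well, since `H` is monic
  have hprime : Prime (C (PowerSeries.X : K⟦X⟧)) := prime_C_iff.2 PowerSeries.X_prime
  have hnd : ¬ C (PowerSeries.X : K⟦X⟧) ∣ H := by
    rw [C_dvd_iff_dvd_coeff]
    intro h
    have := h H.natDegree
    rw [coeff_natDegree, hH.leadingCoeff] at this
    exact PowerSeries.X_prime.not_isUnit (isUnit_of_dvd_one this)
  have hV' : C (PowerSeries.X : K⟦X⟧) ^ M ∣ C (PowerSeries.X ^ (N / e)) * V := by
    apply hprime.pow_dvd_of_dvd_mul_right M hnd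
    refine ⟨C (PowerSeries.X ^ (N / e)) - U' * G, ?_⟩
    rw [← C_pow]
    linear_combination C (PowerSeries.X ^ (N / e)) * hUV - G * hU'
  obtain ⟨V', hV'⟩ := hV'
  change C (PowerSeries.X ^ (N / e)) ∈ Ideal.span {G, H}
  rw [Ideal.mem_span_pair]
  refine ⟨U', V', ?_⟩
  apply mul_left_cancel₀ (pow_ne_zero M hprime.ne_zero)
  rw [← C_pow] at hV' ⊢
  linear_combination C (PowerSeries.X ^ (N / e)) * hUV - G * hU' - H * hV'

end bound

/-! ### Valuations at the Puiseux series roots -/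

section valuations

section rootSeries

variable {L : Type*} [Field L]

/-- The embedding `L⟦T⟧ → HahnSeries ℚ L`, `T ↦ X ^ (1 / e)`. -/
noncomputable def toHahn (L : Type*) [Field L] (e : ℕ) (he : e ≠ 0) : L⟦X⟧ →+* HahnSeries ℚ L :=
  (HahnSeries.embDomainRingHom
    (((AddMonoidHom.mulRight ((e : ℚ)⁻¹)).comp (Nat.castAddMonoidHom ℚ)))
    (fun m n h ↦ by simpa [he] using h)
    (fun m n ↦ by
      have : (0 : ℚ) < (e : ℚ)⁻¹ := by positivity
      simp [mul_le_mul_iff_left₀ this])).comp HahnSeries.toPowerSeries.symm.toRingHom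

variable {e : ℕ} (he : e ≠ 0)

lemma coeff_toHahn_div (y : L⟦X⟧) (n : ℕ) :
    (toHahn L e he y).coeff ((n : ℚ) / e) = PowerSeries.coeff n y := by
  rw [div_eq_mul_inv, ← HahnSeries.coeff_toPowerSeries_symm]
  exact HahnSeries.embDomain_coeff

lemma coeff_toHahn_of_forall_ne (y : L⟦X⟧) {q : ℚ} (hq : ∀ n : ℕ, q ≠ (n : ℚ) / e) :
    (toHahn L e he y).coeff q = 0 := by
  refine HahnSeries.embDomain_of_notMem_range ?_
  rintro ⟨n, rfl⟩
  exact hq n (div_eq_mul_inv _ _).symm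

lemma exists_eq_div_of_mem_support_toHahn {y : L⟦X⟧} {q : ℚ} (hq : q ∈ (toHahn L e he y).support) :
    ∃ n : ℕ, q = (n : ℚ) / e ∧ PowerSeries.coeff n y ≠ 0 := by
  by_contra! h
  refine hq ?_
  by_cases hn : ∃ n : ℕ, q = (n : ℚ) / e
  · obtain ⟨n, rfl⟩ := hn
    rw [coeff_toHahn_div, h n rfl]
  · push Not at hn
    exact coeff_toHahn_of_forall_ne he y hn

lemma isPuiseux_toHahn (y : L⟦X⟧) : IsPuiseux (toHahn L e he y) := by
  refine ⟨e, Nat.pos_of_ne_zero he, fun q hq ↦ ?_⟩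
  obtain ⟨n, hn, -⟩ := exists_eq_div_of_mem_support_toHahn he hq
  exact ⟨n, by simpa using hn⟩

lemma orderTop_toHahn {y : L⟦X⟧} (hy : y ≠ 0) :
    (toHahn L e he y).orderTop = (((y.order.toNat : ℚ) / e : ℚ) : WithTop ℚ) := by
  refine HahnSeries.orderTop_eq_of_le ?_ fun q hq ↦ ?_
  · rw [HahnSeries.mem_support, coeff_toHahn_div]
    exact PowerSeries.coeff_order hy
  · obtain ⟨n, rfl, hn⟩ := exists_eq_div_of_mem_support_toHahn he hq
    have : y.order.toNat ≤ n := by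
      by_contra! h
      exact hn (PowerSeries.coeff_of_lt_order_toNat n h)
    gcongr

lemma toHahn_comp_ramify (K : Type*) [Field K] :
    (toHahn (AlgebraicClosure K) e he).comp (ramify K (AlgebraicClosure K) e he) =
      toPuiseux K := by
  ext x q
  have he' : (e : ℚ) ≠ 0 := by exact_mod_cast he
  have h0 : (∀ m : ℕ, q ≠ m) → (toPuiseux K x).coeff q = 0 := fun h ↦ by
    refine HahnSeries.embDomain_of_notMem_range ?_
    rintro ⟨n, rfl⟩
    exact h n rfl
  rw [RingHom.comp_apply]
  by_cases hn : ∃ n : ℕ, q = (n : ℚ) / e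
  · obtain ⟨n, rfl⟩ := hn
    rw [coeff_toHahn_div, coeff_ramify]
    split_ifs with hd
    · obtain ⟨m, rfl⟩ := hd
      have : ((e * m : ℕ) : ℚ) / e = m := by
        push_cast
        field_simp
      rw [this, Nat.mul_div_cancel_left _ (Nat.pos_of_ne_zero he)]
      exact ((HahnSeries.ofPowerSeries_apply_coeff _ m).trans (PowerSeries.coeff_map _ _ _)).symm
    · refine (h0 fun m hm ↦ hd ⟨m, ?_⟩).symm
      rw [div_eq_iff he'] at hm
      rw [mul_comm]
      exact_mod_cast hm
  · push Not at hn
    rw [coeff_toHahn_of_forall_ne he _ hn]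
    refine (h0 fun m hm ↦ hn (e * m) ?_).symm
    rw [hm]
    push_cast
    field_simp

end rootSeries

variable {K : Type*} [Field K] {e : ℕ} (he : e ≠ 0)

lemma evalAt_toHahn (P : K⟦X⟧[X]) (y : (AlgebraicClosure K)⟦X⟧) :
    evalAt P (toHahn (AlgebraicClosure K) e he y) =
      toHahn (AlgebraicClosure K) e he ((P.map (ramify K (AlgebraicClosure K) e he)).eval y) := by
  rw [evalAt, ← toHahn_comp_ramify he, Polynomial.eval_map, Polynomial.hom_eval₂]

open Lagrange in
/-- The roots of `H` in the field of Hahn series are those found over `L⟦T⟧`, `T = X ^ (1 / e)`. As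
`F` is separable, `F_Y` does not vanish there, and `toNat` is harmless. -/
lemma derivValuations_eq_image {F G H : K⟦X⟧[X]} (hF : SeparableInY F) (hGH : F = G * H)
    {s : Finset (AlgebraicClosure K)⟦X⟧}
    (hs : H.map (ramify K (AlgebraicClosure K) e he) = nodal s id) :
    derivValuations F H = (fun a ↦
      (((((F.derivative.map (ramify K (AlgebraicClosure K) e he)).eval a).order.toNat : ℚ) / e : ℚ)
        : WithTop ℚ)) '' s := by
  have hval : ∀ a ∈ s, (evalAt F.derivative (toHahn (AlgebraicClosure K) e he a)).orderTop =
      (((((F.derivative.map (ramify K (AlgebraicClosure K) e he)).eval a).order.toNat : ℚ) / e : ℚ)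
        : WithTop ℚ) := fun a ha ↦ by
    rw [evalAt_toHahn, orderTop_toHahn he (hF.eval_derivative_ne_zero he ?_)]
    rw [hGH, Polynomial.map_mul, hs, Polynomial.eval_mul, eval_nodal_id ha, mul_zero]
  ext v
  constructor
  · rintro ⟨S, -, hS, rfl⟩
    rw [evalAt, ← toHahn_comp_ramify he, ← Polynomial.eval₂_map, hs, nodal_eq,
      Polynomial.eval₂_finsetProd, Finset.prod_eq_zero_iff] at hS
    obtain ⟨a, ha, h⟩ := hS
    rw [Polynomial.eval₂_sub, Polynomial.eval₂_X, Polynomial.eval₂_C, sub_eq_zero] at h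
    exact ⟨a, ha, by rw [h]; exact (hval a ha).symm⟩
  · rintro ⟨a, ha, rfl⟩
    refine ⟨toHahn (AlgebraicClosure K) e he a, isPuiseux_toHahn he a, ?_, (hval a ha).symm⟩
    rw [evalAt_toHahn, hs, eval_nodal_id ha, map_zero]

lemma kappa_le_of_mem {G H : K⟦X⟧[X]} {k : ℕ} (h : k ∈ liftingExponents G H) : kappa G H ≤ k :=
  Nat.sInf_le h

open Lagrange in
/-- Separability of `F` and `H ≠ 1` give finitely many, at least one, valuations, whose maximum
bounds the lifting order. -/
theorem kappa_le_max {p : ℕ} [CharP K p] {F G H : K⟦X⟧[X]}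
    (hF : SeparableInY F) (hp : p = 0 ∨ F.natDegree < p) (hGH : F = G * H) (hH : H.Monic)
    (hH1 : H ≠ 1) :
    (liftingExponents G H).Nonempty ∧
      ∃ m : ℚ, IsGreatest (derivValuations F H) (m : WithTop ℚ) ∧ (kappa G H : ℚ) ≤ m := by
  obtain ⟨e, he, -, s, hs⟩ := hF.exists_map_ramify_eq_nodal hp hGH hH (AlgebraicClosure K)
  have hsne : s.Nonempty := by
    rw [← Finset.card_pos, ← natDegree_nodal (v := id) (s := s), ← hs, hH.natDegree_map]
    exact Nat.pos_of_ne_zero fun h ↦ hH1 (Polynomial.eq_one_of_monic_natDegree_zero hH h)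
  obtain ⟨b, hb, hmax⟩ := s.exists_max_image (fun a ↦
    ((F.derivative.map (ramify K (AlgebraicClosure K) e he)).eval a).order.toNat) hsne
  have he' : (0 : ℚ) < e := by exact_mod_cast Nat.pos_of_ne_zero he
  have hmem := mem_liftingExponents_of_order_le hF hGH hH he hs (fun a ha ↦ by
    rw [← PowerSeries.coe_toNat_order (hF.eval_derivative_ne_zero he (by
      rw [hGH, Polynomial.map_mul, hs, Polynomial.eval_mul, eval_nodal_id ha, mul_zero]))]
    exact_mod_cast hmax a ha)
  refine ⟨⟨_, hmem⟩, _, ?_, (Nat.cast_le.2 (kappa_le_of_mem hmem)).trans Nat.cast_div_le⟩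
  rw [derivValuations_eq_image he hF hGH hs]
  refine ⟨⟨b, hb, rfl⟩, ?_⟩
  rintro _ ⟨a, ha, rfl⟩
  rw [WithTop.coe_le_coe]
  have := hmax a ha
  gcongr

end valuations

/-! ### Descent of the roots of least valuation -/

section descent

variable {K L : Type*} [Field K] [Field L] [Algebra K L] {e : ℕ} (he : e ≠ 0)

/-- Galois descent from `L⟦T⟧` to `K⟦X⟧`, `X = T ^ e`: the series fixed by the automorphisms of `L`
and by `T ↦ ζ * T` for the `e`-th roots of unity `ζ` are those over `K` in `T ^ e`. -/
lemma mem_range_ramify [IsGalois K L] [HasEnoughRootsOfUnity L e] {y : L⟦X⟧}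
    (hσ : ∀ σ : L ≃ₐ[K] L, PowerSeries.map (σ : L →+* L) y = y)
    (hζ : ∀ ζ : L, ζ ^ e = 1 → PowerSeries.rescale ζ y = y) : y ∈ Set.range (ramify K L e he) := by
  have hK : ∀ n, ∃ k : K, algebraMap K L k = PowerSeries.coeff n y := fun n ↦ by
    refine (InfiniteGalois.mem_range_algebraMap_iff_fixed (k := K) _).2 fun σ ↦ ?_
    conv_rhs => rw [← hσ σ]
    rw [PowerSeries.coeff_map]
    rfl
  choose k hk using hK
  obtain ⟨ζ, hζp⟩ := HasEnoughRootsOfUnity.exists_primitiveRoot L e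
  refine ⟨PowerSeries.mk fun n ↦ k (e * n), ?_⟩
  ext n
  rw [coeff_ramify]
  split_ifs with hd
  · obtain ⟨m, rfl⟩ := hd
    rw [Nat.mul_div_cancel_left _ (Nat.pos_of_ne_zero he), PowerSeries.coeff_mk, hk]
  · have h1 := congrArg (PowerSeries.coeff n) (hζ ζ hζp.pow_eq_one)
    rw [PowerSeries.coeff_rescale] at h1
    by_contra h0
    exact hd (hζp.dvd_of_pow_eq_one n (mul_right_cancel₀ (Ne.symm h0) (h1.trans (one_mul _).symm)))

lemma order_rescale {ζ : L} (hζ : ζ ≠ 0) (y : L⟦X⟧) :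
    (PowerSeries.rescale ζ y).order = y.order := by
  by_cases hy : y = 0
  · simp [hy]
  refine le_antisymm ?_ (PowerSeries.le_order _ _ fun i hi ↦ ?_)
  · rw [← PowerSeries.coe_toNat_order hy]
    exact PowerSeries.order_le _ (by
      rw [PowerSeries.coeff_rescale]
      exact mul_ne_zero (pow_ne_zero _ hζ) (PowerSeries.coeff_order hy))
  · rw [PowerSeries.coeff_rescale, PowerSeries.coeff_of_lt_order _ hi, mul_zero]

lemma map_comp_ramify (σ : L ≃ₐ[K] L) :
    (PowerSeries.map (σ : L →+* L)).comp (ramify K L e he) = ramify K L e he := by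
  ext x n
  rw [RingHom.comp_apply, PowerSeries.coeff_map, coeff_ramify]
  split_ifs <;> simp

lemma rescale_comp_ramify {ζ : L} (hζ : ζ ^ e = 1) :
    (PowerSeries.rescale ζ).comp (ramify K L e he) = ramify K L e he := by
  ext x n
  rw [RingHom.comp_apply, PowerSeries.coeff_rescale, coeff_ramify]
  split_ifs with hd
  · obtain ⟨m, rfl⟩ := hd
    rw [pow_mul, hζ, one_pow, one_mul]
  · rw [mul_zero]

open Polynomial Lagrange in
/-- An order preserving endomorphism `θ` over `K⟦X⟧` permutes the roots `a` of `F` and preserves the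
order of `P(a)`, so it permutes the roots with `ord P(a) ≤ N`. -/
lemma map_nodal_filter_order {F : K⟦X⟧[X]} (P : K⟦X⟧[X]) {s : Finset L⟦X⟧}
    (hs : F.map (ramify K L e he) = nodal s id) {θ : L⟦X⟧ →+* L⟦X⟧}
    (hθ : θ.comp (ramify K L e he) = ramify K L e he) (hord : ∀ y, (θ y).order = y.order) (N : ℕ) :
    (nodal (s.filter fun a ↦ ((P.map (ramify K L e he)).eval a).order ≤ N) id).map θ =
      nodal (s.filter fun a ↦ ((P.map (ramify K L e he)).eval a).order ≤ N) id := by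
  classical
  set O := s.filter fun a ↦ ((P.map (ramify K L e he)).eval a).order ≤ N with hO
  have hinj : Function.Injective θ := (injective_iff_map_eq_zero θ).2 fun y hy ↦ by
    rw [← PowerSeries.order_eq_top, ← hord, hy, PowerSeries.order_zero]
  have hev : ∀ (R : K⟦X⟧[X]) a, (R.map (ramify K L e he)).eval (θ a) =
      θ ((R.map (ramify K L e he)).eval a) := fun R a ↦ by
    conv_lhs => rw [← hθ]
    rw [← Polynomial.map_map, eval_map_apply]
  have himg : O.image θ = O := by
    refine Finset.eq_of_subset_of_card_le ?_ (Finset.card_image_of_injective _ hinj).ge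
    intro b hb
    obtain ⟨a, ha, rfl⟩ := Finset.mem_image.1 hb
    rw [hO, Finset.mem_filter] at ha ⊢
    rw [hev, hord]
    refine ⟨?_, ha.2⟩
    have h0 : (nodal s id).eval (θ a) = 0 := by
      rw [← hs, hev, hs, eval_nodal_id ha.1, map_zero]
    rw [eval_nodal, Finset.prod_eq_zero_iff] at h0
    obtain ⟨c, hc, h⟩ := h0
    rwa [sub_eq_zero.1 h]
  conv_rhs => rw [← himg]
  rw [nodal_eq, nodal_eq, Finset.prod_image hinj.injOn, Polynomial.map_prod]
  simp

open Polynomial Lagrange in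
/-- The roots `a` of `F` with `ord P(a) ≤ N` are the roots of a monic polynomial over `K⟦X⟧`. -/
lemma exists_monic_map_eq_nodal_filter_order [IsGalois K L] [HasEnoughRootsOfUnity L e]
    {F : K⟦X⟧[X]} (P : K⟦X⟧[X]) {s : Finset L⟦X⟧}
    (hs : F.map (ramify K L e he) = nodal s id) (N : ℕ) :
    ∃ H : K⟦X⟧[X], H.Monic ∧ H.map (ramify K L e he) =
      nodal (s.filter fun a ↦ ((P.map (ramify K L e he)).eval a).order ≤ N) id := by
  set D := nodal (s.filter fun a ↦ ((P.map (ramify K L e he)).eval a).order ≤ N) id with hD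
  have hl : D ∈ lifts (ramify K L e he) := by
    rw [lifts_iff_coeff_lifts]
    intro n
    refine mem_range_ramify he (fun σ ↦ ?_) fun ζ hζ ↦ ?_
    · rw [← coeff_map, hD, map_nodal_filter_order he P hs (map_comp_ramify he σ)
        (order_map_fieldHom _)]
    · have hζ0 : ζ ≠ 0 := by
        rintro rfl
        exact zero_ne_one ((zero_pow he).symm.trans hζ)
      rw [← coeff_map, hD, map_nodal_filter_order he P hs (rescale_comp_ramify he hζ)
        (order_rescale hζ0)]
  obtain ⟨H, hH, -, hm⟩ := lifts_and_natDegree_eq_and_monic hl nodal_monic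
  exact ⟨H, hm, hH⟩

open Polynomial Lagrange in
/-- `val (Res_Y(F, F_Y))` is the sum of the valuations of `F_Y` at the roots of `F`, both sides
multiplied by `e`. -/
lemma order_resultant_derivative {F : K⟦X⟧[X]} (hF : F.Monic) {s : Finset L⟦X⟧}
    (hs : F.map (ramify K L e he) = nodal s id) :
    e * (resultant F F.derivative).order =
      ∑ a ∈ s, ((F.derivative.map (ramify K L e he)).eval a).order := by
  have hsp : (F.map (ramify K L e he)).Splits := by
    rw [hs, nodal_eq]
    exact Splits.prod fun a _ ↦ .X_sub_C _
  have hroots : (nodal s id).roots = s.val := roots_prod_X_sub_C s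
  rw [← order_ramify K L he, ← resultant_map_map, ← hF.natDegree_map (ramify K L e he),
    resultant_eq_prod_eval _ _ _ natDegree_map_le hsp, (hF.map _).leadingCoeff, one_pow, one_mul,
    hs, hroots]
  exact PowerSeries.order_prod _ s

end descent

variable {K : Type*} [Field K]

open Polynomial Lagrange in
/-- The roots `S` of `F` where `val (F_Y(S))` is least are the roots of a factor `H` of `F`, and the
least value is at most the mean `δ / d` of the values. If all roots have the same value, then any
factorization will do. -/
theorem exists_mul_of_not_irreducible [PerfectField K] {p : ℕ} [CharP K p] {F : K⟦X⟧[X]}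
    (hFm : F.Monic) (hd : 0 < F.natDegree) (hF : SeparableInY F) (hp : p = 0 ∨ F.natDegree < p)
    (hirr : ¬ Irreducible F) :
    ∃ G H : K⟦X⟧[X], F = G * H ∧ G.Monic ∧ H.Monic ∧ G ≠ 1 ∧ H ≠ 1 ∧
      (liftingExponents G H).Nonempty ∧
      (kappa G H : ℚ) ≤ (delta F : ℚ) / (F.natDegree : ℚ) := by
  obtain ⟨e, he, heL, s, hs⟩ :=
    hF.exists_map_ramify_eq_nodal hp (one_mul F).symm hFm (AlgebraicClosure K)
  have : NeZero (e : AlgebraicClosure K) := ⟨heL⟩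
  have hcard : s.card = F.natDegree := by
    rw [← natDegree_nodal (v := id) (s := s), ← hs, hFm.natDegree_map]
  have hsne : s.Nonempty := Finset.card_pos.1 (hcard ▸ hd)
  set val : (AlgebraicClosure K)⟦X⟧ → ℕ := fun a ↦
    ((F.derivative.map (ramify K (AlgebraicClosure K) e he)).eval a).order.toNat with hval
  have hvalc : ∀ a ∈ s, ((F.derivative.map (ramify K (AlgebraicClosure K) e he)).eval a).order =
      val a := fun a ha ↦ by
    rw [PowerSeries.coe_toNat_order (hF.eval_derivative_ne_zero he (by
      rw [hs, eval_nodal_id ha]))]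
  obtain ⟨b, hb, hmin⟩ := s.exists_min_image val hsne
  have hsum : e * delta F = ∑ a ∈ s, val a := by
    have h1 := order_resultant_derivative he hFm hs
    rw [Finset.sum_congr rfl hvalc, ← Nat.cast_sum] at h1
    have hne : (resultant F F.derivative).order ≠ ⊤ := fun h ↦ by
      rw [h, ENat.mul_top (by exact_mod_cast he)] at h1
      exact ENat.natCast_ne_top _ h1.symm
    rw [← ENat.natCast_toNat hne] at h1
    exact_mod_cast h1
  have hbound : ((val b / e : ℕ) : ℚ) ≤ (delta F : ℚ) / (F.natDegree : ℚ) := by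
    have h2 : F.natDegree * val b ≤ e * delta F := by
      rw [hsum, ← hcard, ← smul_eq_mul]
      exact Finset.card_nsmul_le_sum _ _ _ hmin
    refine Nat.cast_div_le.trans ?_
    rw [div_le_div_iff₀ (by exact_mod_cast Nat.pos_of_ne_zero he) (by exact_mod_cast hd)]
    calc (val b : ℚ) * F.natDegree = F.natDegree * val b := mul_comm _ _
      _ ≤ e * delta F := by exact_mod_cast h2
      _ = delta F * e := mul_comm _ _
  -- it suffices that the roots of `H` are roots of `F` where `F_Y` has the least valuation
  suffices ∃ G H : K⟦X⟧[X], F = G * H ∧ G.Monic ∧ H.Monic ∧ G ≠ 1 ∧ H ≠ 1 ∧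
      ∃ t ⊆ s, H.map (ramify K (AlgebraicClosure K) e he) = nodal t id ∧
        ∀ a ∈ t, val a ≤ val b by
    obtain ⟨G, H, hGH, hG, hH, hG1, hH1, t, hts, ht, hle⟩ := this
    have hmem := mem_liftingExponents_of_order_le (N := val b) hF hGH hH he ht (fun a ha ↦ by
      rw [hvalc a (hts ha)]
      exact_mod_cast hle a ha)
    exact ⟨G, H, hGH, hG, hH, hG1, hH1, ⟨_, hmem⟩,
      (Nat.cast_le.2 (kappa_le_of_mem hmem)).trans hbound⟩
  by_cases hall : ∀ a ∈ s, val a ≤ val b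
  · have h1 : F ≠ 1 := by
      rintro rfl
      simp at hd
    have h2 : ∃ G H : K⟦X⟧[X], G.Monic ∧ H.Monic ∧ G * H = F ∧ G ≠ 1 ∧ H ≠ 1 := by
      rw [irreducible_of_monic hFm h1] at hirr
      push Not at hirr
      exact hirr
    obtain ⟨G, H, hG, hH, hGH, hG1, hH1⟩ := h2
    have hsp : (H.map (ramify K (AlgebraicClosure K) e he)).Splits := by
      refine Splits.of_dvd (g := nodal s id) ?_ nodal_ne_zero ?_
      · rw [nodal_eq]
        exact Splits.prod fun a _ ↦ .X_sub_C _
      · rw [← hs]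
        exact Polynomial.map_dvd _ ⟨G, by rw [← hGH, mul_comm]⟩
    obtain ⟨t, ht⟩ := hF.exists_eq_nodal_of_splits hGH.symm hH he hsp
    have hts : t ⊆ s := fun a ha ↦ by
      have h0 : (nodal s id).eval a = 0 := by
        rw [← hs, ← hGH, Polynomial.map_mul, eval_mul, ht, eval_nodal_id ha, mul_zero]
      rw [eval_nodal, Finset.prod_eq_zero_iff] at h0
      obtain ⟨c, hc, h⟩ := h0
      rwa [sub_eq_zero.1 h]
    exact ⟨G, H, hGH.symm, hG, hH, hG1, hH1, t, hts, ht, fun a ha ↦ hall a (hts ha)⟩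
  · push Not at hall
    obtain ⟨c, hc, hcb⟩ := hall
    obtain ⟨H, hH, hHO⟩ := exists_monic_map_eq_nodal_filter_order he F.derivative hs (val b)
    set O := s.filter fun a ↦
      ((F.derivative.map (ramify K (AlgebraicClosure K) e he)).eval a).order ≤ val b with hO
    have hmemO : ∀ a, a ∈ O ↔ a ∈ s ∧ val a ≤ val b := fun a ↦ by
      rw [hO, Finset.mem_filter]
      exact and_congr_right fun ha ↦ by rw [hvalc a ha, Nat.cast_le]
    have hOs : O ⊆ s := Finset.filter_subset _ _
    have hdvd : H ∣ F := by
      rw [← modByMonic_eq_zero_iff_dvd hH]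
      apply map_injective _ (ramify_injective K (AlgebraicClosure K) he)
      rw [map_modByMonic _ hH, hs, hHO, Polynomial.map_zero,
        modByMonic_eq_zero_iff_dvd nodal_monic]
      exact Finset.prod_dvd_prod_of_subset _ _ _ hOs
    obtain ⟨G, hG⟩ := hdvd
    have hHdeg : H.natDegree = O.card := by
      rw [← natDegree_nodal (v := id) (s := O), ← hHO, hH.natDegree_map]
    refine ⟨G, H, by rw [hG, mul_comm], hH.of_mul_monic_left (hG ▸ hFm), hH, ?_, ?_, O, hOs, hHO,
      fun a ha ↦ ((hmemO a).1 ha).2⟩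
    · rintro rfl
      rw [mul_one] at hG
      have hOe : O = s := Finset.eq_of_subset_of_card_le hOs (by rw [hcard, hG, hHdeg])
      exact absurd ((hmemO c).1 (hOe ▸ hc)).2 (by omega)
    · rintro rfl
      rw [natDegree_one] at hHdeg
      exact Finset.card_ne_zero_of_mem ((hmemO b).2 ⟨hb, le_rfl⟩) hHdeg.symm

end LiftingOrder

theorem mainTheorem10 (K : Type*) [Field K] [PerfectField K] (p : ℕ) [CharP K p] :
    (∀ F G H : K⟦X⟧[X],
      LiftingOrder.SeparableInY F → (p = 0 ∨ F.natDegree < p) →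
      F = G * H → H.Monic → H ≠ 1 →
      (LiftingOrder.liftingExponents G H).Nonempty ∧
      ∃ m : ℚ, IsGreatest (LiftingOrder.derivValuations F H) (m : WithTop ℚ) ∧
        (LiftingOrder.kappa G H : ℚ) ≤ m) ∧
    (∀ F : K⟦X⟧[X],
      F.Monic → 0 < F.natDegree →
      LiftingOrder.SeparableInY F → (p = 0 ∨ F.natDegree < p) →
      ¬ Irreducible F →
      ∃ G H : K⟦X⟧[X], F = G * H ∧ G.Monic ∧ H.Monic ∧ G ≠ 1 ∧ H ≠ 1 ∧
        (LiftingOrder.liftingExponents G H).Nonempty ∧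
        (LiftingOrder.kappa G H : ℚ) ≤ 2 * (LiftingOrder.delta F : ℚ) / (F.natDegree : ℚ)) := by
  refine ⟨fun F G H hF hp hGH hH hH1 ↦ LiftingOrder.kappa_le_max hF hp hGH hH hH1,
    fun F hFm hd hF hp hirr ↦ ?_⟩
  obtain ⟨G, H, hGH, hG, hH, hG1, hH1, hne, hle⟩ :=
    LiftingOrder.exists_mul_of_not_irreducible hFm hd hF hp hirr
  refine ⟨G, H, hGH, hG, hH, hG1, hH1, hne, hle.trans ?_⟩
  gcongr
  exact le_mul_of_one_le_left (Nat.cast_nonneg _) one_le_two
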